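/- Let $\tau\in\mathbb C$ with $t=\operatorname{Im}\tau>0$, let $\Lambda=\mathbb Z+\mathbb Z\tau$, $E=\mathbb C/\Lambda$, let $n\ge 1$ be an integer, $X=E^n$, and let $\xi=a\tau+b$ with $a,b\in\mathbb R$. For $\alpha,\beta\in\mathbb R$ and $\sigma\in\mathbb C$ with $\operatorname{Im}\sigma>0$ put $$\vartheta[\alpha,\beta](z\,|\,\sigma)=\sum_{m\in\mathbb Z}\exp\bigl(\pi i\sigma(m+\alpha)^2+2\pi i(m+\alpha)(z+\beta)\bigr),\qquad \vartheta(z)=\vartheta\bigl[\tfrac12,\tfrac12\bigr](z\,|\,\tau).$$ Let $\varphi(z)=\exp(-\pi i\tau-2\pi i z)$, and let $\mathcal L_{n,\xi}$ be the holomorphic line bundle on $E$ that is the quotient of $\mathbb C\times\mathbb C$ by the equivalence relation generated by $(z,v)\sim(z+1,v)\sim(z+\tau,e^{-2\pi i\xi}\varphi(z)^n v)$. Global holomorphic sections of $\mathcal W=\mathcal L_{n,\xi}\boxtimes\dots\boxtimes\mathcal L_{n,\xi}$ ($n$ factors) on $X$ are identified with the holomorphic functions $F:\mathbb C^n\to\mathbb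 C$ that satisfy, for all $1\le k\le n$, $$F(\dots,z_k+1,\dots)=F(\dots,z_k,\dots),\qquad F(\dots,z_k+\tau,\dots)=e^{-2\pi i\xi}\varphi(z_k)^n F(\dots,z_k,\dots).$$ Writing $z_k=x_k+\tau y_k$ with $x_k,y_k\in\mathbb R$, define the norm of such a section by $$\lVert F\rVert^2=\int_{[0,1]^{2n}}\exp\Bigl(-2\pi n t\sum_{k=1}^n y_k^2-4\pi a t\sum_{k=1}^n y_k\Bigr)\,|F(z_1,\dots,z_n)|^2\,dx_1\,dy_1\cdots dx_n\,dy_n .$$ For $1\le j\le n$ let $s_j(z)=\vartheta\bigl[\tfrac{j-1}{n},0\bigr](nz+\xi\,|\,n\tau)$, and let $$\Phi(z_1,\dots,z_n)=\frac1{\sqrt{n!}}\det\bigl(s_i(z_j)\bigr)_{1\le i,j\le n}.$$ Then: 1. $\Phi$ is a global holomorphic section of $\mathcal W$ on $X$. 2. There is a constant $\mu\in\mathbb C\setminus\{0\}$ such that for all $(z_1,\dots,z_n)\in\mathbb C^n$ $$\Phi(z_1,\dots,z_n)=\mu\cdot\vartheta\Bigl[\frac{n-1}2,\frac{n-1}2\Bigr](z_1+\dots+z_n+\xi\,|\,\tau)\cdot\prod_{1\le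 p<q\le n}\vartheta(z_p-z_q).$$ 3. $\displaystyle\lVert\Phi\rVert=\Bigl(\frac1{2nt}\Bigr)^{n/4}e^{\pi t a^2}.$ -/

import Mathlib

open scoped Nat

noncomputable section

namespace FQHETorus

/-- The theta function with real characteristics `a, b`:
`ϑ[a, b](z | τ) = ∑_{n ∈ ℤ} exp (π i τ (n + a)² + 2 π i (n + a) (z + b))`. -/
def theta (a b : ℝ) (z τ : ℂ) : ℂ :=
  ∑' n : ℤ, Complex.exp
    (Real.pi * Complex.I * τ * ((n : ℂ) + a) ^ 2
      + 2 * Real.pi * Complex.I * ((n : ℂ) + a) * (z + b))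

/-- The odd theta function `ϑ(z) = ϑ[1/2, 1/2](z | τ)`. -/
def thetaOdd (τ z : ℂ) : ℂ := theta (1 / 2) (1 / 2) z τ

/-- `φ(z) = exp (-π i τ - 2 π i z)`. -/
def phi (τ z : ℂ) : ℂ :=
  Complex.exp (-(Real.pi * Complex.I * τ) - 2 * Real.pi * Complex.I * z)

/-! ### The torus `E = ℂ / ⟨1, τ⟩`, its power `X = E × ⋯ × E`, and line bundles on `X` -/

/-- The lattice `Λ = ⟨1, τ⟩_ℤ ⊂ ℂ`. -/
def lattice (τ : ℂ) : AddSubgroup ℂ := AddSubgroup.closure {1, τ}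

/-- The torus `E = ℂ / Λ`. -/
abbrev Torus (τ : ℂ) : Type := ℂ ⧸ lattice τ

/-- The `n`-fold product `X = E × ⋯ × E`. -/
abbrev TorusPow (τ : ℂ) (n : ℕ) : Type := Fin n → Torus τ

/-- The covering map `ℂⁿ → X`. -/
def toTorusPow (τ : ℂ) (n : ℕ) (z : Fin n → ℂ) : TorusPow τ n :=
  fun k => (QuotientAddGroup.mk (z k) : ℂ ⧸ lattice τ)

/-- The generators of the equivalence relation on `ℂⁿ × V`, `V = ℂ`, that defines
`L(c, ψ) ⊠ ⋯ ⊠ L(c, ψ)`: in each variable separately,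
`(z, v) ∼ (z + e_k, c v)` and `(z, v) ∼ (z + τ e_k, ψ(z_k) v)`.
For `n = 1` this is the relation that defines the line bundle `L(c, ψ)` on `E`. -/
inductive BoxRel (τ : ℂ) (n : ℕ) (c : ℂ) (ψ : ℂ → ℂ) :
    (Fin n → ℂ) × ℂ → (Fin n → ℂ) × ℂ → Prop
  | one (z : Fin n → ℂ) (v : ℂ) (k : Fin n) :
      BoxRel τ n c ψ (z, v) (z + Pi.single k 1, c * v)
  | tau (z : Fin n → ℂ) (v : ℂ) (k : Fin n) :
      BoxRel τ n c ψ (z, v) (z + Pi.single k τ, ψ (z k) * v)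

/-- The total space of `L(c, ψ) ⊠ ⋯ ⊠ L(c, ψ)` (`n` factors): the quotient of `ℂⁿ × ℂ` by the
equivalence relation generated by `BoxRel`. -/
def BoxBundle (τ : ℂ) (n : ℕ) (c : ℂ) (ψ : ℂ → ℂ) : Type :=
  Quot (BoxRel τ n c ψ)

/-- The class `[z, v]` in the total space. -/
def BoxBundle.mk {τ : ℂ} {n : ℕ} {c : ℂ} {ψ : ℂ → ℂ} (z : Fin n → ℂ) (v : ℂ) :
    BoxBundle τ n c ψ :=
  Quot.mk _ (z, v)

theorem toTorusPow_add_single (τ : ℂ) (n : ℕ) (z : Fin n → ℂ) (k : Fin n) {w : ℂ}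
    (hw : w ∈ lattice τ) : toTorusPow τ n (z + Pi.single k w) = toTorusPow τ n z := by
  funext j
  refine (QuotientAddGroup.eq.2 ?_).symm
  by_cases h : j = k
  · subst h
    simpa using hw
  · simp [Pi.single_eq_of_ne h]

/-- The bundle projection `[z, v] ↦ [z]`. -/
def BoxBundle.proj {τ : ℂ} {n : ℕ} {c : ℂ} {ψ : ℂ → ℂ} :
    BoxBundle τ n c ψ → TorusPow τ n :=
  Quot.lift (fun p => toTorusPow τ n p.1) (by
    rintro _ _ (⟨z, v, k⟩ | ⟨z, v, k⟩)
    · exact (toTorusPow_add_single τ n z k (AddSubgroup.subset_closure (by simp))).symm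
    · exact (toTorusPow_add_single τ n z k (AddSubgroup.subset_closure (by simp))).symm)

/-- A global holomorphic section of `L(c, ψ) ⊠ ⋯ ⊠ L(c, ψ)`: a right inverse of the projection
that is given by a holomorphic function in the local trivializations `U × ℂ → BoxBundle`,
`(z, v) ↦ [z, v]`, with `U ⊆ ℂⁿ` open. -/
structure BoxBundle.HolomorphicSection (τ : ℂ) (n : ℕ) (c : ℂ) (ψ : ℂ → ℂ) where
  toFun : TorusPow τ n → BoxBundle τ n c ψ
  proj_toFun : ∀ x, (toFun x).proj = x
  holomorphic : ∀ z₀ : Fin n → ℂ, ∃ U : Set (Fin n → ℂ), IsOpen U ∧ z₀ ∈ U ∧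
    ∃ F : (Fin n → ℂ) → ℂ, DifferentiableOn ℂ F U ∧
      ∀ z ∈ U, toFun (toTorusPow τ n z) = BoxBundle.mk z (F z)

/-- The multiplier `e^{-2 π i ξ} φ(z)^k` of the line bundle
`L_{k, ξ} = L(1, e^{-2 π i ξ} φ^k)` of degree `k`. -/
def multiplier (τ : ℂ) (k : ℕ) (ξ z : ℂ) : ℂ :=
  Complex.exp (-(2 * Real.pi * Complex.I * ξ)) * phi τ z ^ k

/-- The global holomorphic sections of `L_{k, ξ} ⊠ ⋯ ⊠ L_{k, ξ}` (`n` factors), identified with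
quasi-periodic holomorphic functions on `ℂⁿ`. -/
def quasiPeriodic (τ : ℂ) (n k : ℕ) (ξ : ℂ) : Set ((Fin n → ℂ) → ℂ) :=
  {Φ | Differentiable ℂ Φ ∧
    (∀ z j, Φ (z + Pi.single j 1) = Φ z) ∧
    (∀ z j, Φ (z + Pi.single j τ) = multiplier τ k ξ (z j) * Φ z)}

/-! ### The hermitian metric and the scalar product -/

/-- The metric `h_{k, ξ}(x, y) = exp (-2 π k t y² - 4 π a t y)` on `L_{k, ξ}` for `ξ = a τ + b`
and `t = Im τ`, in the real coordinates `z = x + τ y`; it does not depend on `x`. -/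
def metric (τ : ℂ) (k : ℕ) (a y : ℝ) : ℝ :=
  Real.exp (-2 * Real.pi * k * τ.im * y ^ 2 - 4 * Real.pi * a * τ.im * y)

/-- The point `(x₁ + τ y₁, …, xₙ + τ yₙ)` of `ℂⁿ`. -/
def point (τ : ℂ) {n : ℕ} (p : Fin n → ℝ × ℝ) : Fin n → ℂ :=
  fun j => ((p j).1 : ℂ) + τ * ((p j).2 : ℂ)

/-- The integrand `h_{k, ξ}(z₁) ⋯ h_{k, ξ}(zₙ) Φ(z) conj(Ψ(z))` of the scalar product. -/
def innerIntegrand (τ : ℂ) (n k : ℕ) (a : ℝ) (Φ Ψ : (Fin n → ℂ) → ℂ) (p : Fin n → ℝ × ℝ) : ℂ :=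
  ((∏ j, metric τ k a (p j).2 : ℝ) : ℂ) * Φ (point τ p) * (starRingEnd ℂ) (Ψ (point τ p))

/-- The cube `[0, 1]^{2 n}`. -/
def cube (n : ℕ) : Set (Fin n → ℝ × ℝ) :=
  Set.univ.pi fun _ => Set.Icc (0 : ℝ) 1 ×ˢ Set.Icc (0 : ℝ) 1

/-- The scalar product
`⟨Φ, Ψ⟩ = ∫_{[0, 1]^{2 n}} h(z₁) ⋯ h(zₙ) Φ(z) conj(Ψ(z)) dx₁ dy₁ ⋯ dxₙ dyₙ`. -/
def scalarProduct (τ : ℂ) (n k : ℕ) (a : ℝ) (Φ Ψ : (Fin n → ℂ) → ℂ) : ℂ :=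
  ∫ p in cube n, innerIntegrand τ n k a Φ Ψ p

/-- The norm `‖Φ‖ = ⟨Φ, Φ⟩^{1/2}`. -/
def sectionNorm (τ : ℂ) (n k : ℕ) (a : ℝ) (Φ : (Fin n → ℂ) → ℂ) : ℝ :=
  Real.sqrt (scalarProduct τ n k a Φ Φ).re

/-! ### The Slater determinant -/

/-- The basis `s_j(z) = ϑ[(j - 1)/k, 0](k z + ξ | k τ)`, `1 ≤ j ≤ k`, of the holomorphic sections
of `L_{k, ξ}`; the index runs over `0, …, k - 1` here. -/
def basisSection (τ : ℂ) (k : ℕ) (ξ : ℂ) (j : Fin k) (z : ℂ) : ℂ :=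
  theta ((j : ℝ) / k) 0 (k * z + ξ) (k * τ)

/-- The normalized Slater determinant `Φ(z₁, …, zₙ) = (n!)^{-1/2} det (s_i(z_j))`. -/
def slater (τ : ℂ) (n : ℕ) (ξ : ℂ) (z : Fin n → ℂ) : ℂ :=
  ((1 / Real.sqrt (n ! : ℝ) : ℝ) : ℂ) *
    (Matrix.of fun i j : Fin n => basisSection τ n ξ i (z j)).det

/-- The function
`ϑ[(n - 1)/2, (n - 1)/2](z₁ + ⋯ + zₙ + ξ | τ) ∏_{p < q} ϑ(z_p - z_q)`. -/
def slaterProduct (τ : ℂ) (n : ℕ) (ξ : ℂ) (z : Fin n → ℂ) : ℂ :=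
  theta (((n : ℝ) - 1) / 2) (((n : ℝ) - 1) / 2) ((∑ k, z k) + ξ) τ *
    ∏ p : Fin n, ∏ q ∈ Finset.Ioi p, thetaOdd τ (z p - z q)

end FQHETorus

end

open FQHETorus

/-!
The Slater determinant is computed from its entries `s_i`, and the product formula is a uniqueness
statement.

*Holomorphic section.* Each `s_i` is, up to an exponential factor, a Jacobi theta function and has the
automorphy factor of `L_{n, ξ}`; the determinant is linear in each column. A quasi-periodic function
`F` descends to the torus because the class `[z, F z]` is unchanged by each generator of the lattice
in each variable (`exists_holomorphicSection`).

*Norm.* The functions `x ↦ s_i (x + τ y)` and `x ↦ s_j (x + τ y)` have Fourier modes in different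
residue classes modulo `n` if `i ≠ j`, so integration over `x` makes the `s_i` orthogonal. For
`i = j` it leaves a sum of Gaussians along `y + ℤ`, which the integration over `y ∈ [0, 1]` unfolds
to one Gaussian integral over `ℝ` (`integral_basisSection_mul_conj`). Expanding both determinants,
only equal pairs of permutations contribute to `⟨Φ, Φ⟩`, so it is the `n`-th power of the squared
norm of `s_i` (`scalarProduct_slater`). In particular the Slater determinant is not identically
zero, and for `n = 1` this says that theta functions do not vanish identically.

*Product formula.* Both sides are antisymmetric and quasi-periodic in each variable. The Fourier
coefficients of a quasi-periodic function of one variable satisfy a recurrence of step `n`, so the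
space of these functions has dimension at most `n`. Choose `w` with `slater τ n ξ w ≠ 0`; then
evaluation at `w_1, …, w_n` is onto `ℂⁿ`, hence also injective
(`eq_zero_of_forall_eval_eq_zero`). Applied to one variable after the other, this shows that an
antisymmetric quasi-periodic function that vanishes at `w` is zero (`eq_zero_of_antisymmetric`), so
the two sides are proportional. The factor is not zero because the product of theta functions does
not vanish identically (`exists_slaterProduct_ne_zero`).
-/

namespace FQHETorus

open Complex MeasureTheory

/-! ### Theta functions with characteristics -/

theorem theta_eq_jacobiTheta₂ (α β : ℝ) (z τ : ℂ) :
    theta α β z τ = cexp (Real.pi * I * τ * α ^ 2 + 2 * Real.pi * I * α * (z + β)) *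
      jacobiTheta₂ (z + β + α * τ) τ := by
  rw [theta, jacobiTheta₂, ← tsum_mul_left]
  refine tsum_congr fun m => ?_
  rw [jacobiTheta₂_term, ← Complex.exp_add]
  congr 1
  ring

theorem differentiable_theta (α β : ℝ) {τ : ℂ} (hτ : 0 < τ.im) :
    Differentiable ℂ fun z => theta α β z τ := by
  have h : Differentiable ℂ fun z => jacobiTheta₂ z τ := fun z =>
    differentiableAt_jacobiTheta₂_fst z hτ
  have h' : Differentiable ℂ fun z => jacobiTheta₂ (z + β + α * τ) τ :=
    h.comp (by fun_prop : Differentiable ℂ fun z : ℂ => z + β + α * τ)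
  simp only [theta_eq_jacobiTheta₂]
  fun_prop

theorem theta_add_one (α β : ℝ) (z τ : ℂ) :
    theta α β (z + 1) τ = cexp (2 * Real.pi * I * α) * theta α β z τ := by
  rw [theta_eq_jacobiTheta₂, theta_eq_jacobiTheta₂,
    show z + 1 + β + α * τ = z + β + α * τ + 1 by ring, jacobiTheta₂_add_left, ← mul_assoc,
    ← Complex.exp_add]
  congr 2
  ring

theorem theta_add_natCast (α β : ℝ) (z τ : ℂ) (N : ℕ) :
    theta α β (z + N) τ = cexp (2 * Real.pi * I * (α * N)) * theta α β z τ := by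
  induction N with
  | zero => simp
  | succ N ih =>
    rw [Nat.cast_succ, ← add_assoc, theta_add_one, ih, ← mul_assoc, ← Complex.exp_add]
    congr 2
    ring

theorem theta_add_tau (α β : ℝ) (z τ : ℂ) :
    theta α β (z + τ) τ =
      cexp (-(Real.pi * I * τ) - 2 * Real.pi * I * (z + β)) * theta α β z τ := by
  rw [theta_eq_jacobiTheta₂, theta_eq_jacobiTheta₂,
    show z + τ + β + α * τ = z + β + α * τ + τ by ring, jacobiTheta₂_add_left', ← mul_assoc,
    ← mul_assoc, ← Complex.exp_add, ← Complex.exp_add]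
  congr 2
  ring

theorem thetaOdd_neg (τ z : ℂ) : thetaOdd τ (-z) = -thetaOdd τ z := by
  rw [thetaOdd, thetaOdd, theta, theta, ← (Equiv.subLeft (-1 : ℤ)).tsum_eq, ← tsum_neg]
  refine tsum_congr fun m => ?_
  have h : cexp (-((m : ℂ) * (2 * Real.pi * I)) - Real.pi * I) = -1 := by
    rw [Complex.exp_sub, Complex.exp_pi_mul_I, Complex.exp_neg, Complex.exp_int_mul_two_pi_mul_I]
    norm_num
  rw [neg_eq_neg_one_mul (cexp _), ← h, ← Complex.exp_add]
  congr 1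
  simp only [Equiv.subLeft_apply]
  push_cast
  ring

/-! ### Quasi-periodic functions of one variable -/

/-- The space of entire functions `f` on `ℂ` with `f (z + 1) = f z` and
`f (z + τ) = multiplier τ n ξ z * f z`, i.e. of the holomorphic sections of `L_{n, ξ}` over the
torus. -/
def quasiPeriodicOne (τ : ℂ) (n : ℕ) (ξ : ℂ) : Submodule ℂ (ℂ → ℂ) where
  carrier := {f | Differentiable ℂ f ∧ (∀ z, f (z + 1) = f z) ∧
    ∀ z, f (z + τ) = multiplier τ n ξ z * f z}
  zero_mem' := ⟨differentiable_const 0, by simp, by simp⟩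
  add_mem' := by
    rintro f g ⟨hf, hf₁, hf₂⟩ ⟨hg, hg₁, hg₂⟩
    refine ⟨hf.add hg, fun z => by simp [hf₁, hg₁], fun z => ?_⟩
    simp only [Pi.add_apply, hf₂, hg₂]
    ring
  smul_mem' := by
    rintro c f ⟨hf, hf₁, hf₂⟩
    refine ⟨hf.const_smul c, fun z => by simp [hf₁], fun z => ?_⟩
    simp only [Pi.smul_apply, hf₂, smul_eq_mul]
    ring

theorem im_natCast_mul_pos {τ : ℂ} (hτ : 0 < τ.im) {n : ℕ} (hn : 0 < n) :
    0 < ((n : ℂ) * τ).im := by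
  rw [← Complex.ofReal_natCast, Complex.im_ofReal_mul]
  positivity

theorem basisSection_mem (τ : ℂ) (hτ : 0 < τ.im) (n : ℕ) (ξ : ℂ) (j : Fin n) :
    basisSection τ n ξ j ∈ quasiPeriodicOne τ n ξ := by
  have hn : 0 < n := j.pos
  have hn' : (n : ℂ) ≠ 0 := by exact_mod_cast hn.ne'
  refine ⟨?_, fun z => ?_, fun z => ?_⟩
  · exact (differentiable_theta _ _ (im_natCast_mul_pos hτ hn)).comp
      (by fun_prop : Differentiable ℂ fun z : ℂ => (n : ℂ) * z + ξ)
  · rw [basisSection, basisSection, show (n : ℂ) * (z + 1) + ξ = n * z + ξ + n by ring,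
      theta_add_natCast]
    have : (((((j : ℕ) : ℝ) / n : ℝ) : ℂ)) * n = ((j : ℕ) : ℤ) := by
      push_cast
      field_simp
    rw [this, mul_comm (2 * (Real.pi : ℂ) * I), Complex.exp_int_mul_two_pi_mul_I, one_mul]
  · rw [basisSection, basisSection, show (n : ℂ) * (z + τ) + ξ = n * z + ξ + n * τ by ring,
      theta_add_tau, multiplier, phi, ← Complex.exp_nat_mul, ← Complex.exp_add]
    congr 2
    push_cast
    ring

/-- The integral of a holomorphic function of period `1` over a horizontal period does not depend
on the height: the integrals over the two vertical sides of a rectangle of width `1` cancel. -/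
theorem integral_add_eq_of_periodic {g : ℂ → ℂ} (hg : Differentiable ℂ g)
    (hg₁ : ∀ z, g (z + 1) = g z) (w : ℂ) :
    ∫ x in (0 : ℝ)..1, g (x + w) = ∫ x in (0 : ℝ)..1, g x := by
  have h := Complex.integral_boundary_rect_eq_zero_of_differentiableOn g (w.re : ℂ)
    (w + 1) hg.differentiableOn
  have e₁ : ∀ y : ℝ, g ((w.re + 1 : ℝ) + y * I) = g (w.re + y * I) := fun y => by
    rw [← hg₁ (w.re + y * I)]
    congr 1
    push_cast
    ring
  simp only [zero_mul, Complex.ofReal_re, Complex.ofReal_im, Complex.add_re,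
    Complex.one_re, Complex.add_im, Complex.one_im, add_zero, e₁, add_sub_cancel_right,
    Complex.ofReal_zero] at h
  rw [sub_eq_zero] at h
  have p : Function.Periodic (fun x : ℝ => g x) 1 := fun x => by
    simp only [Complex.ofReal_add, Complex.ofReal_one, hg₁]
  rw [p.intervalIntegral_add_eq w.re 0, zero_add] at h
  have q := intervalIntegral.integral_comp_add_right (a := 0) (b := 1)
    (fun x : ℝ => g (x + w.im * I)) w.re
  rw [zero_add, add_comm 1 w.re] at q
  rw [h, ← q]
  refine intervalIntegral.integral_congr fun x _ => ?_
  simp only [Complex.ofReal_add, add_assoc, Complex.re_add_im]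

/-- The `k`-th Fourier coefficient of the restriction to `ℝ` of a function of period `1`. -/
noncomputable def realFourierCoeff (k : ℤ) (f : ℂ → ℂ) : ℂ :=
  ∫ x in (0 : ℝ)..1, f x * cexp (-(2 * Real.pi * I * k * x))

/-- An entire function of period `1` all of whose Fourier coefficients vanish is zero: it vanishes
on `ℝ`, hence everywhere by the identity theorem. -/
theorem eq_zero_of_realFourierCoeff_eq_zero {f : ℂ → ℂ} (hf : Differentiable ℂ f)
    (hf₁ : ∀ z, f (z + 1) = f z) (h : ∀ k, realFourierCoeff k f = 0) : f = 0 := by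
  have p : Function.Periodic (fun x : ℝ => f x) 1 := fun x => by
    simp only [Complex.ofReal_add, Complex.ofReal_one, hf₁]
  have hc : Continuous fun x : ℝ => f x := hf.continuous.comp Complex.continuous_ofReal
  let F : C(AddCircle (1 : ℝ), ℂ) := ⟨p.lift, continuous_quot_lift _ hc⟩
  have hF : ∀ x : ℝ, F x = f x := fun x => p.lift_coe x
  have h0 : ∀ k, fourierCoeff F k = 0 := fun k => by
    rw [fourierCoeff_eq_intervalIntegral _ k 0, zero_add]
    refine (congrArg _ (Eq.trans ?_ (h k))).trans (smul_zero _)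
    refine intervalIntegral.integral_congr fun x _ => ?_
    simp only [hF, fourier_coe_apply, smul_eq_mul, mul_comm (f x)]
    congr 2
    push_cast
    ring
  have hreal : ∀ x : ℝ, f x = 0 := fun x => by
    have hs : Summable (fourierCoeff F) := by
      rw [show fourierCoeff F = 0 from funext h0]
      exact summable_zero
    have := has_pointwise_sum_fourier_series_of_summable hs (x : AddCircle (1 : ℝ))
    simp only [h0, zero_smul, hF] at this
    exact this.unique hasSum_zero
  refine AnalyticOnNhd.eq_of_frequently_eq (z₀ := 0)
    (fun z _ => hf.analyticAt z) (fun z _ => analyticAt_const) ?_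
  have ht : Filter.Tendsto (fun x : ℝ => (x : ℂ)) (nhdsWithin 0 {0}ᶜ) (nhdsWithin 0 {0}ᶜ) := by
    refine tendsto_nhdsWithin_iff.2 ⟨?_, ?_⟩
    · exact (Complex.continuous_ofReal.tendsto' 0 0 rfl).mono_left nhdsWithin_le_nhds
    · filter_upwards [self_mem_nhdsWithin] with x hx
      simpa using hx
  exact ht.frequently (Filter.Eventually.frequently (Filter.Eventually.of_forall hreal))

/-- Quasi-periodicity in the direction `τ` is a recurrence for Fourier coefficients. -/
theorem realFourierCoeff_add {τ : ℂ} {n : ℕ} {ξ : ℂ} {f : ℂ → ℂ}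
    (hf : f ∈ quasiPeriodicOne τ n ξ) (k : ℤ) :
    realFourierCoeff k f = cexp (-(2 * Real.pi * I * ξ) - n * (Real.pi * I * τ)
      - 2 * Real.pi * I * k * τ) * realFourierCoeff (k + n) f := by
  obtain ⟨hd, h₁, hτ⟩ := hf
  have := integral_add_eq_of_periodic (g := fun z => f z * cexp (-(2 * Real.pi * I * k * z)))
    (by fun_prop) (fun z => by
      rw [h₁, show -(2 * Real.pi * I * k * (z + 1)) = -(2 * Real.pi * I * k * z)
        + ((-k : ℤ) : ℂ) * (2 * Real.pi * I) by push_cast; ring, Complex.exp_add,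
        Complex.exp_int_mul_two_pi_mul_I, mul_one]) τ
  rw [realFourierCoeff, ← this, realFourierCoeff, ← intervalIntegral.integral_const_mul]
  refine intervalIntegral.integral_congr fun x _ => ?_
  simp only [hτ, multiplier, phi, ← Complex.exp_nat_mul]
  rw [mul_left_comm _ (f x), mul_comm _ (f x), mul_assoc, ← Complex.exp_add, ← Complex.exp_add,
    ← Complex.exp_add]
  congr 2
  push_cast
  ring

/-- A quasi-periodic function is determined by `n` consecutive Fourier coefficients. -/
theorem eq_zero_of_forall_fin {τ : ℂ} {n : ℕ} {ξ : ℂ} {f : ℂ → ℂ} (hn : 1 ≤ n)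
    (hf : f ∈ quasiPeriodicOne τ n ξ) (h : ∀ k : Fin n, realFourierCoeff (k : ℕ) f = 0) :
    f = 0 := by
  refine eq_zero_of_realFourierCoeff_eq_zero hf.1 hf.2.1 fun k => ?_
  have step : ∀ k, realFourierCoeff k f = 0 ↔ realFourierCoeff (k + n) f = 0 := fun k => by
    rw [realFourierCoeff_add hf k, mul_eq_zero, or_iff_right (Complex.exp_ne_zero _)]
  have key : ∀ r q : ℤ, realFourierCoeff r f = 0 → realFourierCoeff (r + n * q) f = 0 := by
    intro r q hr
    induction q using Int.induction_on with
    | zero => simpa using hr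
    | succ i ih =>
      rw [mul_add, mul_one, ← add_assoc]
      exact (step _).1 ih
    | pred i ih =>
      rw [step]
      rwa [mul_sub, mul_one, add_assoc, sub_add_cancel]
  have hn' : (0 : ℤ) < n := by exact_mod_cast hn
  rw [← Int.emod_add_mul_ediv k n]
  refine key _ _ ?_
  have h1 := Int.emod_nonneg k hn'.ne'
  have h2 := Int.emod_lt_of_pos k hn'
  have := h ⟨(k % n).toNat, by omega⟩
  rwa [Int.toNat_of_nonneg h1] at this

/-- If the sections `s_j` separate the points `w_1, …, w_n`, then a quasi-periodic function that
vanishes at these points is zero: the `n` Fourier coefficients embed the space of quasi-periodic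
functions into `ℂⁿ`, and evaluation at the `w_j` maps it onto `ℂⁿ`. -/
theorem eq_zero_of_forall_eval_eq_zero {τ : ℂ} (hτ : 0 < τ.im) {n : ℕ} (hn : 1 ≤ n) {ξ : ℂ}
    {w : Fin n → ℂ} (hw : (Matrix.of fun i j : Fin n => basisSection τ n ξ i (w j)).det ≠ 0)
    {f : ℂ → ℂ} (hf : f ∈ quasiPeriodicOne τ n ξ) (h : ∀ j, f (w j) = 0) : f = 0 := by
  have hint : ∀ (k : ℤ) (g : quasiPeriodicOne τ n ξ), IntervalIntegrable
      (fun x : ℝ => (g : ℂ → ℂ) x * cexp (-(2 * Real.pi * I * k * x))) volume 0 1 :=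
    fun k g => by
      have := g.2.1.continuous
      exact Continuous.intervalIntegrable (by fun_prop) _ _
  let A : quasiPeriodicOne τ n ξ →ₗ[ℂ] Fin n → ℂ :=
    { toFun := fun g k => realFourierCoeff (k : ℕ) g
      map_add' := fun g g' => by
        funext k
        simp only [realFourierCoeff, Submodule.coe_add, Pi.add_apply, add_mul]
        exact intervalIntegral.integral_add (hint _ g) (hint _ g')
      map_smul' := fun c g => by
        funext k
        simp only [realFourierCoeff, Submodule.coe_smul, Pi.smul_apply, smul_eq_mul, mul_assoc,
          RingHom.id_apply]
        exact intervalIntegral.integral_const_mul _ _ }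
  have hA : Function.Injective A := by
    refine (injective_iff_map_eq_zero A).2 fun g hg => ?_
    exact Subtype.ext (eq_zero_of_forall_fin hn g.2 fun k => congrFun hg k)
  have hfin : FiniteDimensional ℂ (quasiPeriodicOne τ n ξ) := FiniteDimensional.of_injective A hA
  let B : quasiPeriodicOne τ n ξ →ₗ[ℂ] Fin n → ℂ :=
    { toFun := fun g j => (g : ℂ → ℂ) (w j)
      map_add' := fun _ _ => rfl
      map_smul' := fun _ _ => rfl }
  have hB : Function.Surjective B := by
    intro v
    set M := Matrix.of fun i j : Fin n => basisSection τ n ξ i (w j) with hM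
    refine ⟨∑ i, Matrix.vecMul v M⁻¹ i • ⟨_, basisSection_mem τ hτ n ξ i⟩, ?_⟩
    have : Matrix.vecMul (Matrix.vecMul v M⁻¹) M = v := by
      rw [Matrix.vecMul_vecMul, Matrix.nonsing_inv_mul _ (Ne.isUnit hw), Matrix.vecMul_one]
    rw [map_sum]
    conv_rhs => rw [← this]
    funext j
    simp [B, Matrix.vecMul, dotProduct, hM]
  have hBi : Function.Injective B := by
    refine (LinearMap.injective_iff_surjective_of_finrank_eq_finrank (le_antisymm ?_ ?_)).2 hB
    · exact LinearMap.finrank_le_finrank_of_injective hA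
    · exact LinearMap.finrank_le_finrank_of_surjective hB
  have : (⟨f, hf⟩ : quasiPeriodicOne τ n ξ) = 0 := hBi (by
    rw [map_zero]
    exact funext h)
  exact congrArg Subtype.val this

/-! ### The Slater determinant as a holomorphic section -/

theorem add_single_eq_update {n : ℕ} (z : Fin n → ℂ) (k : Fin n) (w : ℂ) :
    z + Pi.single k w = Function.update z k (z k + w) := by
  funext j
  by_cases h : j = k
  · subst h; simp
  · simp [h]

theorem slater_update_mem (τ : ℂ) (hτ : 0 < τ.im) (n : ℕ) (ξ : ℂ) (z : Fin n → ℂ) (k : Fin n) :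
    (fun u => slater τ n ξ (Function.update z k u)) ∈ quasiPeriodicOne τ n ξ := by
  set M := Matrix.of fun i j : Fin n => basisSection τ n ξ i (z j) with hM
  have h : ∀ u, (Matrix.of fun i j : Fin n =>
      basisSection τ n ξ i (Function.update z k u j)) =
      M.updateCol k fun i => basisSection τ n ξ i u := fun u => by
    ext i j
    by_cases hj : j = k
    · subst hj; simp
    · simp [hj, hM]
  -- the determinant is linear in the column `k`, the only one that depends on `u`
  have h' : (fun u => slater τ n ξ (Function.update z k u)) =
      ((1 / Real.sqrt (n ! : ℝ) : ℝ) : ℂ) • ∑ i, (M.cramer fun j => if i = j then 1 else 0) k •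
        basisSection τ n ξ i := by
    funext u
    rw [slater, h, ← Matrix.cramer_apply,
      LinearMap.pi_apply_eq_sum_univ M.cramer fun i => basisSection τ n ξ i u]
    simp [mul_comm]
  rw [h']
  exact Submodule.smul_mem _ _ (Submodule.sum_mem _ fun i _ =>
    Submodule.smul_mem _ _ (basisSection_mem τ hτ n ξ i))

theorem differentiable_slater (τ : ℂ) (hτ : 0 < τ.im) (n : ℕ) (ξ : ℂ) :
    Differentiable ℂ (slater τ n ξ) := by
  have h : ∀ i j : Fin n, Differentiable ℂ fun z : Fin n → ℂ => basisSection τ n ξ i (z j) :=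
    fun i j => (basisSection_mem τ hτ n ξ i).1.comp (differentiable_apply j)
  unfold slater
  simp only [Matrix.det_apply, Matrix.of_apply]
  refine (Differentiable.fun_sum fun σ _ => ?_).const_mul _
  exact Differentiable.const_smul (f := fun z : Fin n → ℂ => ∏ j, basisSection τ n ξ (σ j) (z j))
    (fun z => (HasFDerivAt.finsetProd fun j _ =>
      (h (σ j) j z).hasFDerivAt).differentiableAt) _

theorem slater_mem_quasiPeriodic (τ : ℂ) (hτ : 0 < τ.im) (n : ℕ) (ξ : ℂ) :
    slater τ n ξ ∈ quasiPeriodic τ n n ξ := by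
  refine ⟨differentiable_slater τ hτ n ξ, fun z k => ?_, fun z k => ?_⟩
  · simpa [add_single_eq_update] using (slater_update_mem τ hτ n ξ z k).2.1 (z k)
  · simpa [add_single_eq_update] using (slater_update_mem τ hτ n ξ z k).2.2 (z k)

/-- For a quasi-periodic function `F`, the classes `[z, F z]` depend only on the image of `z` in
the torus. -/
theorem boxBundle_mk_eq_of_toTorusPow_eq {τ : ℂ} {n k : ℕ} {ξ : ℂ} {F : (Fin n → ℂ) → ℂ}
    (hF : F ∈ quasiPeriodic τ n k ξ) {z z' : Fin n → ℂ}
    (h : toTorusPow τ n z = toTorusPow τ n z') :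
    (BoxBundle.mk z (F z) : BoxBundle τ n 1 (multiplier τ k ξ)) = BoxBundle.mk z' (F z') := by
  obtain ⟨-, h₁, hτ⟩ := hF
  have single : ∀ (j : Fin n) (w : ℂ), w ∈ lattice τ → ∀ z : Fin n → ℂ,
      (BoxBundle.mk (z + Pi.single j w) (F (z + Pi.single j w)) :
        BoxBundle τ n 1 (multiplier τ k ξ)) = BoxBundle.mk z (F z) := by
    intro j w hw
    induction hw using AddSubgroup.closure_induction with
    | mem w hw =>
      intro z
      rcases hw with rfl | rfl
      · refine (Quot.sound ?_).symm
        rw [h₁]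
        simpa using BoxRel.one (τ := τ) (c := 1) (ψ := multiplier τ k ξ) z (F z) j
      · refine (Quot.sound ?_).symm
        rw [hτ]
        exact BoxRel.tau z (F z) j
    | zero => intro z; simp
    | add u v _ _ hu hv =>
      intro z
      rw [Pi.single_add, ← add_assoc, hv, hu]
    | neg u _ hu =>
      intro z
      have := hu (z + Pi.single j (-u))
      rw [add_assoc, ← Pi.single_add, neg_add_cancel, Pi.single_zero, add_zero] at this
      exact this.symm
  have mem : ∀ j, z' j - z j ∈ lattice τ := fun j => by
    have := QuotientAddGroup.eq.1 (congrFun h j)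
    rwa [neg_add_eq_sub] at this
  have key : ∀ s : Finset (Fin n),
      (BoxBundle.mk (z + ∑ j ∈ s, Pi.single j (z' j - z j))
        (F (z + ∑ j ∈ s, Pi.single j (z' j - z j))) :
        BoxBundle τ n 1 (multiplier τ k ξ)) = BoxBundle.mk z (F z) := by
    intro s
    induction s using Finset.induction_on with
    | empty => simp
    | insert j s hj ih =>
      rw [Finset.sum_insert hj, add_comm (Pi.single j _), ← add_assoc, single j _ (mem j), ih]
  have hz : z + ∑ j, Pi.single j (z' j - z j) = z' := by
    rw [Finset.univ_sum_single fun j => z' j - z j]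
    funext j
    simp
  rw [← key Finset.univ, hz]

/-- A quasi-periodic holomorphic function on `ℂⁿ` descends to a holomorphic section. -/
theorem exists_holomorphicSection {τ : ℂ} {n k : ℕ} {ξ : ℂ} {F : (Fin n → ℂ) → ℂ}
    (hF : F ∈ quasiPeriodic τ n k ξ) :
    ∃ σ : BoxBundle.HolomorphicSection τ n 1 (multiplier τ k ξ),
      ∀ z : Fin n → ℂ, σ.toFun (toTorusPow τ n z) = BoxBundle.mk z (F z) := by
  have hsurj : ∀ x : TorusPow τ n, ∃ z, toTorusPow τ n z = x := fun x => by
    choose z hz using fun j => QuotientAddGroup.mk_surjective (x j)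
    exact ⟨z, funext hz⟩
  choose r hr using hsurj
  have h : ∀ z, (BoxBundle.mk (r (toTorusPow τ n z)) (F (r (toTorusPow τ n z))) :
      BoxBundle τ n 1 (multiplier τ k ξ)) = BoxBundle.mk z (F z) := fun z =>
    boxBundle_mk_eq_of_toTorusPow_eq hF (hr _)
  exact ⟨⟨fun x => BoxBundle.mk (r x) (F (r x)), hr, fun z₀ => ⟨Set.univ, isOpen_univ,
    Set.mem_univ _, F, hF.1.differentiableOn, fun z _ => h z⟩⟩, h⟩

/-! ### Antisymmetric quasi-periodic functions -/

theorem slater_comp_perm (τ : ℂ) (n : ℕ) (ξ : ℂ) (σ : Equiv.Perm (Fin n)) (z : Fin n → ℂ) :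
    slater τ n ξ (z ∘ σ) = (Equiv.Perm.sign σ : ℤ) * slater τ n ξ z := by
  have := Matrix.det_permute' σ (Matrix.of fun i j : Fin n => basisSection τ n ξ i (z j))
  rw [slater, slater, mul_left_comm, ← this]
  rfl

theorem slaterProduct_comp_perm (τ : ℂ) (n : ℕ) (ξ : ℂ) (σ : Equiv.Perm (Fin n))
    (z : Fin n → ℂ) :
    slaterProduct τ n ξ (z ∘ σ) = (Equiv.Perm.sign σ : ℤ) * slaterProduct τ n ξ z := by
  have := σ.prod_Ioi_comp_eq_sign_mul_prod (f := fun p q => thetaOdd τ (z p - z q))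
    (fun p q => by rw [← thetaOdd_neg, neg_sub])
  simp only [slaterProduct, Function.comp_apply, this, Equiv.sum_comp σ z]
  ring

theorem slaterProduct_cons (τ : ℂ) (m : ℕ) (ξ u : ℂ) (y : Fin m → ℂ) :
    slaterProduct τ (m + 1) ξ (Fin.cons u y) =
      (∏ p : Fin m, ∏ q ∈ Finset.Ioi p, thetaOdd τ (y p - y q)) *
        (theta ((m : ℝ) / 2) ((m : ℝ) / 2) (u + (∑ k, y k + ξ)) τ *
          ∏ q, thetaOdd τ (u - y q)) := by
  rw [slaterProduct, Fin.prod_univ_succ, Fin.sum_univ_succ]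
  simp only [Fin.prod_Ioi_zero, Fin.prod_Ioi_succ, Fin.cons_zero, Fin.cons_succ]
  rw [show ((m + 1 : ℕ) : ℝ) - 1 = m by push_cast; ring, add_assoc]
  ring

/-- The product is quasi-periodic in the first variable: the `m` odd theta functions and the theta
function of the centre of mass contribute automorphy factors whose product is the multiplier of
degree `m + 1`. -/
theorem slaterProduct_cons_mem (τ : ℂ) (hτ : 0 < τ.im) (m : ℕ) (ξ : ℂ) (y : Fin m → ℂ) :
    (fun u => slaterProduct τ (m + 1) ξ (Fin.cons u y)) ∈ quasiPeriodicOne τ (m + 1) ξ := by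
  have hd : ∀ α β (c : ℂ), Differentiable ℂ fun u => theta α β (u + c) τ := fun α β c =>
    (differentiable_theta α β hτ).comp (by fun_prop : Differentiable ℂ fun u : ℂ => u + c)
  simp only [slaterProduct_cons]
  refine Submodule.smul_mem _ _ ⟨?_, fun u => ?_, fun u => ?_⟩
  · refine (hd _ _ _).mul (Differentiable.fun_finsetProd fun q _ => ?_)
    simpa only [thetaOdd, sub_eq_add_neg] using hd _ _ (-y q)
  · have h₁ : ∀ z, thetaOdd τ (z + 1) = -1 * thetaOdd τ z := fun z => by
      rw [thetaOdd, theta_add_one, ← Complex.exp_pi_mul_I]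
      congr 2
      push_cast
      ring
    simp only [add_right_comm u 1, add_sub_right_comm u 1, theta_add_one, h₁,
      Finset.prod_mul_distrib, Finset.prod_const, Finset.card_univ, Fintype.card_fin]
    have : cexp (2 * Real.pi * I * ((m : ℝ) / 2 : ℝ)) * (-1) ^ m = 1 := by
      rw [← Complex.exp_pi_mul_I, ← Complex.exp_nat_mul, ← Complex.exp_add]
      refine (congrArg cexp ?_).trans (Complex.exp_nat_mul_two_pi_mul_I m)
      push_cast
      ring
    linear_combination (theta ((m : ℝ) / 2) ((m : ℝ) / 2) (u + (∑ k, y k + ξ)) τ *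
          ∏ q, thetaOdd τ (u - y q)) * this
  · simp only [thetaOdd, add_right_comm u τ, add_sub_right_comm u τ, theta_add_tau,
      Finset.prod_mul_distrib, ← Complex.exp_sum]
    have : cexp (-(Real.pi * I * τ) -
          2 * Real.pi * I * (u + (∑ k, y k + ξ) + ((m : ℝ) / 2 : ℝ))) *
        cexp (∑ q, (-(Real.pi * I * τ) - 2 * Real.pi * I * (u - y q + (1 / 2 : ℝ)))) =
        multiplier τ (m + 1) ξ u := by
      rw [multiplier, phi, ← Complex.exp_nat_mul, ← Complex.exp_add, ← Complex.exp_add,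
        Complex.exp_eq_exp_iff_exists_int]
      refine ⟨-m, ?_⟩
      simp only [mul_add, mul_sub, Finset.sum_sub_distrib, Finset.sum_add_distrib,
        Finset.sum_const, Finset.card_univ, Fintype.card_fin, nsmul_eq_mul, ← Finset.mul_sum]
      push_cast
      ring
    rw [← this]
    ring

theorem slaterProduct_update_mem (τ : ℂ) (hτ : 0 < τ.im) (n : ℕ) (ξ : ℂ) (z : Fin n → ℂ)
    (k : Fin n) :
    (fun u => slaterProduct τ n ξ (Function.update z k u)) ∈ quasiPeriodicOne τ n ξ := by
  obtain _ | m := n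
  · exact k.elim0
  -- antisymmetry moves the variable `k` to the first place
  have h : (fun u => slaterProduct τ (m + 1) ξ (Function.update z k u)) =
      ((Equiv.Perm.sign (Equiv.swap 0 k) : ℤ) : ℂ) • fun u =>
        slaterProduct τ (m + 1) ξ (Fin.cons u (Fin.tail (z ∘ Equiv.swap 0 k))) := by
    funext u
    have e : Function.update z k u =
        (Fin.cons u (Fin.tail (z ∘ Equiv.swap 0 k)) : Fin (m + 1) → ℂ) ∘ Equiv.swap 0 k := by
      have : (Fin.cons u (Fin.tail (z ∘ Equiv.swap 0 k)) : Fin (m + 1) → ℂ) =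
          Function.update (z ∘ Equiv.swap 0 k) 0 u := by
        rw [← Fin.update_cons_zero (z k), show z k = (z ∘ Equiv.swap 0 k) 0 by simp,
          Fin.cons_self_tail]
      rw [this]
      funext j
      by_cases hj : j = k
      · subst hj; simp
      · have : Equiv.swap 0 k j ≠ 0 := fun h0 => hj (by
          rwa [Equiv.swap_apply_eq_iff, Equiv.swap_apply_left] at h0)
        simp [hj, this]
    rw [e, slaterProduct_comp_perm]
    rfl
  rw [h]
  exact Submodule.smul_mem _ _ (slaterProduct_cons_mem τ hτ m ξ _)

/-- An antisymmetric function that is quasi-periodic in each variable vanishes if it vanishes at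
one point `w` at which the Slater determinant does not: by antisymmetry it vanishes at all points
with coordinates among the `w_j`, and these coordinates can be freed one after the other. -/
theorem eq_zero_of_antisymmetric {τ : ℂ} (hτ : 0 < τ.im) {n : ℕ} (hn : 1 ≤ n) {ξ : ℂ}
    {w : Fin n → ℂ} (hw : slater τ n ξ w ≠ 0) {G : (Fin n → ℂ) → ℂ}
    (hG : ∀ z k, (fun u => G (Function.update z k u)) ∈ quasiPeriodicOne τ n ξ)
    (hsign : ∀ (σ : Equiv.Perm (Fin n)) z, G (z ∘ σ) = (Equiv.Perm.sign σ : ℤ) * G z)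
    (h0 : G w = 0) (z : Fin n → ℂ) : G z = 0 := by
  have key : ∀ s : Finset (Fin n), ∀ z : Fin n → ℂ, (∀ k ∉ s, ∃ j, z k = w j) → G z = 0 := by
    intro s
    induction s using Finset.induction_on with
    | empty =>
      intro z hz
      choose J hJ using fun k => hz k (Finset.notMem_empty k)
      obtain rfl : z = w ∘ J := funext hJ
      by_cases hi : Function.Injective J
      · have := hsign (Equiv.ofBijective J (Finite.injective_iff_bijective.1 hi)) w
        rw [h0, mul_zero] at this
        exact this
      · -- two equal coordinates: the transposition changes the sign and fixes the point
        simp only [Function.Injective, not_forall] at hi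
        obtain ⟨p, q, hpq, hne⟩ := hi
        have e : (w ∘ J) ∘ Equiv.swap p q = w ∘ J := by
          funext k
          rcases eq_or_ne k p with rfl | hp
          · simp [hpq]
          rcases eq_or_ne k q with rfl | hq
          · simp [hpq]
          simp [Equiv.swap_apply_of_ne_of_ne hp hq]
        have := hsign (Equiv.swap p q) (w ∘ J)
        rw [e, Equiv.Perm.sign_swap hne] at this
        push_cast at this
        linear_combination this / 2
    | insert k s hk ih =>
      intro z hz
      have := eq_zero_of_forall_eval_eq_zero hτ hn (right_ne_zero_of_mul hw) (hG z k)
        fun j => ih _ fun l hl => by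
          by_cases hlk : l = k
          · subst hlk; exact ⟨j, by simp⟩
          · simpa [hlk] using hz l (by simp [hlk, hl])
      simpa using congrFun this (z k)
  exact key Finset.univ z fun k hk => absurd (Finset.mem_univ k) hk

/-- Antisymmetric quasi-periodic functions form a space of dimension one, so the two such functions
`slater` and `slaterProduct` are proportional. -/
theorem exists_slater_eq_mul_slaterProduct {τ : ℂ} (hτ : 0 < τ.im) {n : ℕ} (hn : 1 ≤ n) {ξ : ℂ}
    {w w' : Fin n → ℂ} (hw : slater τ n ξ w ≠ 0) (hw' : slaterProduct τ n ξ w' ≠ 0) :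
    ∃ μ : ℂ, μ ≠ 0 ∧ ∀ z : Fin n → ℂ, slater τ n ξ z = μ * slaterProduct τ n ξ z := by
  have key : ∀ z, slater τ n ξ w * slaterProduct τ n ξ z -
      slaterProduct τ n ξ w * slater τ n ξ z = 0 := by
    refine eq_zero_of_antisymmetric hτ hn hw (fun z k => ?_) (fun σ z => ?_) (by ring)
    · exact Submodule.sub_mem _
        (Submodule.smul_mem _ (slater τ n ξ w) (slaterProduct_update_mem τ hτ n ξ z k))
        (Submodule.smul_mem _ (slaterProduct τ n ξ w) (slater_update_mem τ hτ n ξ z k))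
    · rw [slater_comp_perm, slaterProduct_comp_perm]
      ring
  have hP : slaterProduct τ n ξ w ≠ 0 := fun h => by
    have := key w'
    rw [h, zero_mul, sub_zero] at this
    exact mul_ne_zero hw hw' this
  refine ⟨slater τ n ξ w / slaterProduct τ n ξ w, div_ne_zero hw hP, fun z => ?_⟩
  field_simp
  linear_combination -key z

/-! ### Orthogonality of the basis sections -/

/-- The coefficient of `e^{2 π i (n m + j) x}` in the Fourier expansion of `s_j (x + τ y)` in the
variable `x`. -/
noncomputable def modeCoeff (τ : ℂ) (n : ℕ) (ξ : ℂ) (j : Fin n) (y : ℝ) (m : ℤ) : ℂ :=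
  cexp (Real.pi * I * (n * τ) * (m + (j : ℕ) / n) ^ 2
    + 2 * Real.pi * I * (m + (j : ℕ) / n) * (n * (τ * y) + ξ))

/-- A Fourier mode `e^{2 π i k x}`. -/
noncomputable def fourierMode (k : ℤ) (x : ℝ) : ℂ := cexp (2 * Real.pi * I * k * x)

theorem norm_fourierMode (k : ℤ) (x : ℝ) : ‖fourierMode k x‖ = 1 := by
  rw [fourierMode, show 2 * Real.pi * I * k * x = ((2 * Real.pi * k * x : ℝ) : ℂ) * I by
    push_cast; ring, Complex.norm_exp_ofReal_mul_I]

theorem conj_fourierMode (k : ℤ) (x : ℝ) :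
    (starRingEnd ℂ) (fourierMode k x) = fourierMode (-k) x := by
  rw [fourierMode, fourierMode, ← Complex.exp_conj]
  simp [map_ofNat (starRingEnd ℂ) 2]

theorem fourierMode_mul (k l : ℤ) (x : ℝ) :
    fourierMode k x * fourierMode l x = fourierMode (k + l) x := by
  simp only [fourierMode]
  rw [← Complex.exp_add]
  congr 1
  push_cast
  ring

theorem integral_fourierMode (k : ℤ) :
    ∫ x in (0 : ℝ)..1, fourierMode k x = if k = 0 then 1 else 0 := by
  split_ifs with hk
  · simp [fourierMode, hk]
  · have hc : 2 * Real.pi * I * k ≠ 0 :=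
      mul_ne_zero Complex.two_pi_I_ne_zero (Int.cast_ne_zero.2 hk)
    simp only [fourierMode]
    rw [integral_exp_mul_complex hc, show 2 * Real.pi * I * k * ((1 : ℝ) : ℂ) =
      k * (2 * Real.pi * I) by push_cast; ring, Complex.exp_int_mul_two_pi_mul_I]
    simp

theorem summable_norm_modeCoeff {τ : ℂ} (hτ : 0 < τ.im) (n : ℕ) (ξ : ℂ) (j : Fin n) (y : ℝ) :
    Summable fun m => ‖modeCoeff τ n ξ j y m‖ := by
  refine Summable.norm ?_
  have h := (summable_jacobiTheta₂_term_iff ((n * (τ * y) + ξ) + (j : ℕ) / n * (n * τ))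
    (n * τ)).2 (im_natCast_mul_pos hτ j.pos)
  refine (h.mul_left (cexp (Real.pi * I * (n * τ) * ((j : ℕ) / n) ^ 2 +
    2 * Real.pi * I * ((j : ℕ) / n) * (n * (τ * y) + ξ)))).congr fun m => ?_
  rw [jacobiTheta₂_term, modeCoeff, ← Complex.exp_add]
  congr 1
  ring

theorem basisSection_eq_tsum (τ : ℂ) (n : ℕ) (ξ : ℂ) (j : Fin n) (x y : ℝ) :
    basisSection τ n ξ j (x + τ * y) =
      ∑' m : ℤ, modeCoeff τ n ξ j y m * fourierMode (n * m + (j : ℕ)) x := by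
  have hn : (n : ℂ) ≠ 0 := by exact_mod_cast j.pos.ne'
  rw [basisSection, theta]
  refine tsum_congr fun m => ?_
  rw [modeCoeff, fourierMode, ← Complex.exp_add]
  congr 1
  push_cast
  field_simp
  ring

/-- Integration over `x` kills all products of distinct Fourier modes. -/
theorem hasSum_integral_basisSection_mul_conj {τ : ℂ} (hτ : 0 < τ.im) (n : ℕ) (ξ : ℂ)
    (i j : Fin n) (y : ℝ) :
    HasSum (fun m => if i = j then ((‖modeCoeff τ n ξ i y m‖ ^ 2 : ℝ) : ℂ) else 0)
      (∫ x in (0 : ℝ)..1, basisSection τ n ξ i (x + τ * y) *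
        (starRingEnd ℂ) (basisSection τ n ξ j (x + τ * y))) := by
  set A := modeCoeff τ n ξ i y with hA
  set B := modeCoeff τ n ξ j y with hB
  have sA : Summable fun m => ‖A m‖ := summable_norm_modeCoeff hτ n ξ i y
  have sB : Summable fun m => ‖B m‖ := summable_norm_modeCoeff hτ n ξ j y
  let F : ℤ × ℤ → ℝ → ℂ := fun p x => (A p.1 * fourierMode (n * p.1 + (i : ℕ)) x) *
    (starRingEnd ℂ) (B p.2 * fourierMode (n * p.2 + (j : ℕ)) x)
  have hF : ∀ p x, F p x = A p.1 * (starRingEnd ℂ) (B p.2) *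
      fourierMode (n * p.1 + (i : ℕ) - (n * p.2 + (j : ℕ))) x := fun p x => by
    simp only [F, map_mul, conj_fourierMode]
    rw [sub_eq_add_neg, ← fourierMode_mul (n * p.1 + (i : ℕ))]
    ring
  have hcont : ∀ p, Continuous (F p) := fun p => by
    have : F p = fun x => _ := funext (hF p)
    rw [this]
    unfold fourierMode
    fun_prop
  have hnorm : ∀ p x, ‖F p x‖ = ‖A p.1‖ * ‖B p.2‖ := fun p x => by
    rw [hF, norm_mul, norm_mul, norm_fourierMode, mul_one, RCLike.norm_conj]
  have hsum := hasSum_integral_of_summable_integral_norm (F := F)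
    (μ := volume.restrict (Set.Ioc (0 : ℝ) 1))
    (fun p => ((hcont p).integrableOn_Icc).mono_set Set.Ioc_subset_Icc_self) (by
      simp only [hnorm]
      refine (sA.mul_of_nonneg sB (fun _ => norm_nonneg _) fun _ => norm_nonneg _).congr
        fun p => ?_
      simp)
  have htsum : ∀ x, ∑' p, F p x = basisSection τ n ξ i (x + τ * y) *
      (starRingEnd ℂ) (basisSection τ n ξ j (x + τ * y)) := fun x => by
    rw [basisSection_eq_tsum, basisSection_eq_tsum, Complex.conj_tsum]
    refine (tsum_mul_tsum_of_summable_norm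
      (f := fun m => A m * fourierMode (n * m + (i : ℕ)) x)
      (g := fun m => (starRingEnd ℂ) (B m * fourierMode (n * m + (j : ℕ)) x))
      (sA.congr fun m => ?_) (sB.congr fun m => ?_)).symm
    · rw [norm_mul, norm_fourierMode, mul_one]
    · rw [RCLike.norm_conj, norm_mul, norm_fourierMode, mul_one]
  simp only [htsum, ← intervalIntegral.integral_of_le zero_le_one] at hsum
  have hint : ∀ p : ℤ × ℤ, ∫ x in (0 : ℝ)..1, F p x = A p.1 * (starRingEnd ℂ) (B p.2) *
      if i = j ∧ p.1 = p.2 then 1 else 0 := fun p => by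
    simp only [hF]
    rw [intervalIntegral.integral_const_mul, integral_fourierMode]
    congr 1
    refine if_congr ⟨fun h => ?_, ?_⟩ rfl rfl
    · -- the residue of `n m + j` modulo `n` determines `j`
      have hi : (i : ℕ) = j := by
        have := congrArg (· % (n : ℤ)) (sub_eq_zero.1 h)
        simp only [Int.mul_add_emod_self_left] at this
        rw [Int.emod_eq_of_lt (by omega) (by omega), Int.emod_eq_of_lt (by omega) (by omega)] at this
        exact_mod_cast this
      refine ⟨Fin.ext hi, ?_⟩
      rw [hi, sub_eq_zero, add_left_inj] at h
      exact mul_left_cancel₀ (by exact_mod_cast i.pos.ne') h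
    · rintro ⟨rfl, h⟩
      rw [h, sub_self]
  have hinj : Function.Injective fun m : ℤ => (m, m) := fun m m' h => (Prod.ext_iff.1 h).1
  rw [← hinj.hasSum_iff] at hsum
  · refine (congrArg (HasSum · _) (funext fun m => ?_)).mpr hsum
    rw [Function.comp_apply, hint]
    by_cases hij : i = j
    · subst hij
      simp [Complex.mul_conj, Complex.normSq_eq_norm_sq, hA, hB]
    · simp [hij]
  · rintro ⟨m, m'⟩ hm
    rw [hint, if_neg, mul_zero]
    rintro ⟨-, h⟩
    exact hm ⟨m, Prod.ext rfl h⟩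

/-- The weight and the coefficients `modeCoeff` combine to a single Gaussian, sampled along
`y + ℤ`. -/
theorem metric_mul_norm_modeCoeff_sq (τ : ℂ) (n : ℕ) (a b : ℝ) (j : Fin n) (y : ℝ) (m : ℤ) :
    metric τ n a y * ‖modeCoeff τ n (a * τ + b) j y m‖ ^ 2 =
      Real.exp (2 * Real.pi * τ.im * a ^ 2 / n) *
        Real.exp (-(2 * Real.pi * n * τ.im) * (y + m + ((j : ℕ) + a) / n) ^ 2) := by
  have hn : (n : ℝ) ≠ 0 := by exact_mod_cast j.pos.ne'
  set c : ℝ := m + (j : ℕ) / n with hc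
  have h : Real.pi * I * (n * τ) * (m + (j : ℕ) / n) ^ 2
      + 2 * Real.pi * I * (m + (j : ℕ) / n) * (n * (τ * y) + (a * τ + b)) =
      ((Real.pi * n * c ^ 2 + 2 * Real.pi * c * (n * y + a) : ℝ) : ℂ) * (I * τ) +
        ((2 * Real.pi * c * b : ℝ) : ℂ) * I := by
    rw [hc]
    push_cast
    ring
  rw [modeCoeff, h, Complex.norm_exp, metric, ← Real.exp_nat_mul, ← Real.exp_add, ← Real.exp_add,
    Complex.add_re, Complex.re_ofReal_mul, Complex.re_ofReal_mul, Complex.I_mul_re, Complex.I_re]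
  congr 1
  rw [show y + m + ((j : ℕ) + a) / n = c + y + a / n by rw [hc]; ring]
  push_cast
  field_simp
  ring

/-- The squared norm of each `s_j`, a Gaussian integral over `ℝ`. -/
noncomputable def basisNormSq (τ : ℂ) (n : ℕ) (a : ℝ) : ℝ :=
  Real.exp (2 * Real.pi * τ.im * a ^ 2 / n) * Real.sqrt (1 / (2 * n * τ.im))

theorem integral_metric_mul_integral_basisSection {τ : ℂ} (hτ : 0 < τ.im) (n : ℕ) (a b : ℝ)
    (i j : Fin n) :
    ∫ y in (0 : ℝ)..1, (metric τ n a y : ℂ) * ∫ x in (0 : ℝ)..1,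
      basisSection τ n (a * τ + b) i (x + τ * y) *
        (starRingEnd ℂ) (basisSection τ n (a * τ + b) j (x + τ * y)) =
      if i = j then (basisNormSq τ n a : ℂ) else 0 := by
  split_ifs with hij
  · subst hij
    set f : ℝ → ℝ := fun v => Real.exp (2 * Real.pi * τ.im * a ^ 2 / n) *
      Real.exp (-(2 * Real.pi * n * τ.im) * (v + ((i : ℕ) + a) / n) ^ 2) with hf
    have hn : 0 < (n : ℝ) := by exact_mod_cast i.pos
    have hpos : 0 < 2 * Real.pi * n * τ.im := by have := Real.pi_pos; positivity
    have hfi : Integrable f :=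
      ((integrable_exp_neg_mul_sq hpos).comp_add_right _).const_mul _
    have hfI : ∫ v, f v = basisNormSq τ n a := by
      simp only [hf]
      rw [integral_const_mul,
        integral_add_right_eq_self (fun v => Real.exp (-(2 * Real.pi * n * τ.im) * v ^ 2)),
        integral_gaussian, basisNormSq]
      congr 2
      field_simp
    have hterm : ∀ y : ℝ, HasSum (fun m : ℤ => ((f (y + m) : ℝ) : ℂ))
        ((metric τ n a y : ℂ) * ∫ x in (0 : ℝ)..1, basisSection τ n (a * τ + b) i (x + τ * y) *
          (starRingEnd ℂ) (basisSection τ n (a * τ + b) i (x + τ * y))) := fun y => by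
      refine (congrArg (HasSum · _) (funext fun m => ?_)).mpr
        ((hasSum_integral_basisSection_mul_conj hτ n (a * τ + b) i i y).mul_left
          (metric τ n a y : ℂ))
      rw [if_pos rfl, ← Complex.ofReal_mul, metric_mul_norm_modeCoeff_sq]
    have hunfold := hfi.hasSum_intervalIntegral_comp_add_int
    have hfc : Continuous f := by fun_prop
    have hsum := hasSum_integral_of_summable_integral_norm
      (F := fun (m : ℤ) (y : ℝ) => ((f (y + m) : ℝ) : ℂ))
      (μ := volume.restrict (Set.Ioc (0 : ℝ) 1))
      (fun m => (Continuous.integrableOn_Icc (by fun_prop)).mono_set Set.Ioc_subset_Icc_self) (by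
        refine hunfold.summable.congr fun m => ?_
        rw [intervalIntegral.integral_of_le zero_le_one]
        refine integral_congr_ae (Filter.Eventually.of_forall fun y => ?_)
        simp only [Complex.norm_real, Real.norm_eq_abs]
        exact (abs_of_nonneg (by positivity)).symm)
    simp only [← intervalIntegral.integral_of_le zero_le_one, intervalIntegral.integral_ofReal,
      fun y => (hterm y).tsum_eq] at hsum
    rw [← hfI]
    exact hsum.unique (Complex.hasSum_ofReal.2 hunfold)
  · refine (intervalIntegral.integral_congr (g := fun _ => 0) fun y _ => ?_).trans (by simp)
    have := hasSum_integral_basisSection_mul_conj hτ n (a * τ + b) i j y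
    simp only [if_neg hij] at this
    simp only [this.unique hasSum_zero, mul_zero]

theorem continuous_metric (τ : ℂ) (k : ℕ) (a : ℝ) : Continuous (metric τ k a) := by
  unfold metric
  fun_prop

/-- The sections `s_j` are orthogonal and of equal norm. -/
theorem integral_basisSection_mul_conj {τ : ℂ} (hτ : 0 < τ.im) (n : ℕ) (a b : ℝ) (i j : Fin n) :
    ∫ p in Set.Icc (0 : ℝ) 1 ×ˢ Set.Icc (0 : ℝ) 1, (metric τ n a p.2 : ℂ) *
      (basisSection τ n (a * τ + b) i (p.1 + τ * p.2) *
        (starRingEnd ℂ) (basisSection τ n (a * τ + b) j (p.1 + τ * p.2))) =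
      if i = j then (basisNormSq τ n a : ℂ) else 0 := by
  have hs : ∀ l : Fin n, Continuous (basisSection τ n (a * τ + b) l) := fun l =>
    (basisSection_mem τ hτ n _ l).1.continuous
  have hm := continuous_metric τ n a
  have hc : Continuous fun p : ℝ × ℝ => (metric τ n a p.2 : ℂ) *
      (basisSection τ n (a * τ + b) i (p.1 + τ * p.2) *
        (starRingEnd ℂ) (basisSection τ n (a * τ + b) j (p.1 + τ * p.2))) := by
    have := hs i
    have := hs j
    refine .mul (by fun_prop) (.mul (by fun_prop) (Complex.continuous_conj.comp (by fun_prop)))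
  have hi := hc.continuousOn.integrableOn_compact
    (μ := volume) ((isCompact_Icc (a := (0 : ℝ)) (b := 1)).prod (isCompact_Icc (a := (0 : ℝ)) (b := 1)))
  rw [← integral_metric_mul_integral_basisSection hτ n a b i j]
  rw [IntegrableOn, Measure.volume_eq_prod, ← Measure.prod_restrict] at hi
  rw [Measure.volume_eq_prod, ← Measure.prod_restrict, integral_prod_symm _ hi,
    integral_Icc_eq_integral_Ioc, ← intervalIntegral.integral_of_le zero_le_one]
  refine intervalIntegral.integral_congr fun y _ => ?_
  simp only
  rw [integral_const_mul, integral_Icc_eq_integral_Ioc,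
    ← intervalIntegral.integral_of_le zero_le_one]

/-! ### The norm of the Slater determinant -/

theorem isCompact_cube (n : ℕ) : IsCompact (cube n) :=
  isCompact_univ_pi fun _ => isCompact_Icc.prod isCompact_Icc

theorem integrableOn_innerIntegrand (τ : ℂ) {n : ℕ} (k : ℕ) (a : ℝ) {Φ Ψ : (Fin n → ℂ) → ℂ}
    (hΦ : Continuous Φ) (hΨ : Continuous Ψ) :
    IntegrableOn (innerIntegrand τ n k a Φ Ψ) (cube n) := by
  have hm := continuous_metric τ k a
  have hp : Continuous (point τ : (Fin n → ℝ × ℝ) → Fin n → ℂ) := by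
    unfold point
    fun_prop
  refine ContinuousOn.integrableOn_compact (isCompact_cube n) (Continuous.continuousOn ?_)
  unfold innerIntegrand
  refine .mul (.mul ?_ (hΦ.comp hp)) (Complex.continuous_conj.comp (hΨ.comp hp))
  fun_prop

/-- Fubini for a product function on the cube. -/
theorem integral_cube_prod {n : ℕ} (f : Fin n → ℝ × ℝ → ℂ) :
    ∫ p in cube n, ∏ j, f j (p j) =
      ∏ j, ∫ p in Set.Icc (0 : ℝ) 1 ×ˢ Set.Icc (0 : ℝ) 1, f j p := by
  rw [cube, volume_pi, Measure.restrict_pi_pi, integral_fintype_prod_eq_prod]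

theorem scalarProduct_slater {τ : ℂ} (hτ : 0 < τ.im) (n : ℕ) (a b : ℝ) :
    scalarProduct τ n n a (slater τ n (a * τ + b)) (slater τ n (a * τ + b)) =
      ((basisNormSq τ n a ^ n : ℝ) : ℂ) := by
  set s := basisSection τ n (a * τ + b) with hs
  -- `K i j` is the integrand of `⟨s_i, s_j⟩`
  let K : Fin n → Fin n → ℝ × ℝ → ℂ := fun i j p => (metric τ n a p.2 : ℂ) *
    (s i (p.1 + τ * p.2) * (starRingEnd ℂ) (s j (p.1 + τ * p.2)))
  have hK : ∀ i j, Continuous (K i j) := fun i j => by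
    have hm := continuous_metric τ n a
    have h : ∀ l : Fin n, Continuous (s l) := fun l => (basisSection_mem τ hτ n _ l).1.continuous
    have := h i
    have := h j
    exact .mul (by fun_prop) (.mul (by fun_prop) (Complex.continuous_conj.comp (by fun_prop)))
  have hexp : ∀ p, innerIntegrand τ n n a (slater τ n (a * τ + b)) (slater τ n (a * τ + b)) p =
      ((1 / (n ! : ℝ) : ℝ) : ℂ) * ∑ σ : Equiv.Perm (Fin n), ∑ ρ : Equiv.Perm (Fin n),
        ((Equiv.Perm.sign σ : ℤ) * (Equiv.Perm.sign ρ : ℤ) : ℂ) * ∏ j, K (σ j) (ρ j) (p j) := by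
    intro p
    have hsq : ((1 / Real.sqrt (n ! : ℝ) : ℝ) : ℂ) * ((1 / Real.sqrt (n ! : ℝ) : ℝ) : ℂ) =
        ((1 / (n ! : ℝ) : ℝ) : ℂ) := by
      rw [← Complex.ofReal_mul, div_mul_div_comm, one_mul, Real.mul_self_sqrt (by positivity)]
    have hfactor : ∀ (M : ℂ) (f P Q : Equiv.Perm (Fin n) → ℂ),
        ∑ σ, ∑ ρ, (f σ * f ρ) * (M * (P σ * Q ρ)) =
          M * ((∑ σ, f σ * P σ) * ∑ ρ, f ρ * Q ρ) := fun M f P Q => by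
      rw [Finset.sum_mul_sum, Finset.mul_sum]
      refine Finset.sum_congr rfl fun σ _ => ?_
      rw [Finset.mul_sum]
      refine Finset.sum_congr rfl fun ρ _ => ?_
      ring
    simp only [K, Finset.prod_mul_distrib]
    rw [hfactor, innerIntegrand, slater, Matrix.det_apply', ← hsq]
    simp only [map_mul, Complex.conj_ofReal, Matrix.of_apply, map_sum, map_prod, map_intCast,
      Complex.ofReal_prod, ← hs, point]
    ring
  have hint : ∀ σ ρ : Equiv.Perm (Fin n), IntegrableOn (fun p => ((Equiv.Perm.sign σ : ℤ) *
      (Equiv.Perm.sign ρ : ℤ) : ℂ) * ∏ j, K (σ j) (ρ j) (p j)) (cube n) := fun σ ρ =>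
    ContinuousOn.integrableOn_compact (isCompact_cube n) (Continuous.continuousOn
      (continuous_const.mul (continuous_finsetProd _ fun j _ =>
        (hK _ _).comp (continuous_apply j))))
  have hprod : ∀ σ ρ : Equiv.Perm (Fin n), ∫ p in cube n, ((Equiv.Perm.sign σ : ℤ) *
      (Equiv.Perm.sign ρ : ℤ) : ℂ) * ∏ j, K (σ j) (ρ j) (p j) =
      if σ = ρ then ((basisNormSq τ n a ^ n : ℝ) : ℂ) else 0 := fun σ ρ => by
    rw [integral_const_mul, integral_cube_prod]
    simp only [K, hs, integral_basisSection_mul_conj hτ n a b, Finset.prod_ite_zero,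
      Finset.mem_univ, true_implies, Finset.prod_const, Finset.card_univ, Fintype.card_fin]
    by_cases h : σ = ρ
    · subst h
      rw [if_pos fun _ => rfl, if_pos rfl, ← Int.cast_mul, ← Units.val_mul, Int.units_mul_self]
      simp
    · rw [if_neg fun h' => h (Equiv.ext h'), if_neg h, mul_zero]
  rw [scalarProduct]
  simp only [hexp]
  rw [integral_const_mul, integral_finsetSum _ fun σ _ => integrable_finsetSum _ fun ρ _ => hint σ ρ]
  simp only [integral_finsetSum _ fun ρ _ => hint _ ρ, hprod, Finset.sum_ite_eq, Finset.mem_univ,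
    if_true, Finset.sum_const, Finset.card_univ, Fintype.card_perm, Fintype.card_fin, nsmul_eq_mul]
  have : ((n ! : ℕ) : ℂ) ≠ 0 := by exact_mod_cast n.factorial_ne_zero
  push_cast
  field_simp

theorem sectionNorm_slater {τ : ℂ} (hτ : 0 < τ.im) {n : ℕ} (hn : 1 ≤ n) (a b : ℝ) :
    sectionNorm τ n n a (slater τ n (a * τ + b)) =
      (1 / (2 * (n : ℝ) * τ.im)) ^ ((n : ℝ) / 4) * Real.exp (Real.pi * τ.im * a ^ 2) := by
  have hn' : (0 : ℝ) < n := by exact_mod_cast hn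
  have hb : 0 < 1 / (2 * (n : ℝ) * τ.im) := by positivity
  rw [sectionNorm, scalarProduct_slater hτ, Complex.ofReal_re,
    Real.sqrt_eq_iff_mul_self_eq (by unfold basisNormSq; positivity) (by positivity),
    mul_mul_mul_comm, ← Real.rpow_add hb, ← Real.exp_add, basisNormSq, mul_pow,
    ← Real.exp_nat_mul, Real.sqrt_eq_rpow, ← Real.rpow_mul_natCast hb.le, mul_comm]
  congr 1
  · congr 1
    ring
  · congr 1
    field_simp
    ring

theorem exists_slater_ne_zero {τ : ℂ} (hτ : 0 < τ.im) {n : ℕ} (hn : 1 ≤ n) (a b : ℝ) :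
    ∃ w, slater τ n (a * τ + b) w ≠ 0 := by
  by_contra! h
  have hn' : (0 : ℝ) < n := by exact_mod_cast hn
  have h₁ := scalarProduct_slater hτ n a b
  have h₂ : (0 : ℝ) < basisNormSq τ n a ^ n := by
    unfold basisNormSq
    positivity
  simp only [scalarProduct, innerIntegrand, h, mul_zero, zero_mul, integral_zero] at h₁
  exact h₂.ne (by exact_mod_cast h₁)

/-! ### The product does not vanish identically -/

theorem exists_theta_ne_zero {τ : ℂ} (hτ : 0 < τ.im) (α β : ℝ) : ∃ z, theta α β z τ ≠ 0 := by
  -- for `n = 1` the Slater determinant is the theta function with characteristics `0, 0`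
  obtain ⟨w, hw⟩ := exists_slater_ne_zero hτ le_rfl 0 0
  have h₀ : jacobiTheta₂ (w 0) τ ≠ 0 := fun h0 => hw (by
    simp [slater, basisSection, theta_eq_jacobiTheta₂, h0])
  refine ⟨w 0 - β - α * τ, ?_⟩
  rw [theta_eq_jacobiTheta₂]
  refine mul_ne_zero (Complex.exp_ne_zero _) ?_
  rwa [sub_right_comm, sub_add_cancel, sub_add_cancel]

theorem eventually_theta_comp_ne_zero {τ : ℂ} (hτ : 0 < τ.im) (α β : ℝ) {c : ℂ} (hc : c ≠ 0)
    (d : ℂ) : ∀ᶠ u in nhdsWithin (0 : ℂ) {0}ᶜ, theta α β (c * u + d) τ ≠ 0 := by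
  by_contra h
  have hd : Differentiable ℂ fun u => theta α β (c * u + d) τ :=
    (differentiable_theta α β hτ).comp (by fun_prop : Differentiable ℂ fun u : ℂ => c * u + d)
  have h0 := AnalyticOnNhd.eq_of_frequently_eq (z₀ := 0) (fun z _ => hd.analyticAt z)
    (fun z _ => analyticAt_const (v := (0 : ℂ))) h
  obtain ⟨z, hz⟩ := exists_theta_ne_zero hτ α β
  refine hz ?_
  have := congrFun h0 ((z - d) / c)
  simpa only [mul_div_cancel₀ _ hc, sub_add_cancel] using this

/-- The product is not identically zero: along the line `z_k = (k + 1) u` each of its factors is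
an entire function of `u` that is not identically zero, so it vanishes at no `u ≠ 0` close to
`0`. -/
theorem exists_slaterProduct_ne_zero {τ : ℂ} (hτ : 0 < τ.im) {n : ℕ} (hn : 1 ≤ n) (ξ : ℂ) :
    ∃ w, slaterProduct τ n ξ w ≠ 0 := by
  have hsum : (∑ k : Fin n, (((k : ℕ) : ℂ) + 1)) ≠ 0 := by
    have : 0 < ∑ k : Fin n, ((k : ℕ) + 1) :=
      Finset.sum_pos (fun k _ => Nat.succ_pos _) ⟨⟨0, hn⟩, Finset.mem_univ _⟩
    exact_mod_cast this.ne'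
  have h₁ := eventually_theta_comp_ne_zero hτ (((n : ℝ) - 1) / 2) (((n : ℝ) - 1) / 2) hsum ξ
  have h₂ : ∀ᶠ u in nhdsWithin (0 : ℂ) {0}ᶜ, ∀ p : Fin n, ∀ q ∈ Finset.Ioi p,
      thetaOdd τ ((((p : ℕ) : ℂ) + 1) * u - (((q : ℕ) : ℂ) + 1) * u) ≠ 0 := by
    refine Filter.eventually_all.2 fun p => (Filter.eventually_all_finset _).2 fun q hq => ?_
    have hpq : ((p : ℕ) : ℂ) - ((q : ℕ) : ℂ) ≠ 0 := by
      rw [sub_ne_zero]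
      exact_mod_cast (Fin.val_fin_lt.2 (Finset.mem_Ioi.1 hq)).ne
    filter_upwards [eventually_theta_comp_ne_zero hτ (1 / 2) (1 / 2) hpq 0] with u hu
    rw [thetaOdd]
    convert hu using 2
    ring
  obtain ⟨u, hu₁, hu₂⟩ := (h₁.and h₂).exists
  refine ⟨fun k => (((k : ℕ) : ℂ) + 1) * u, mul_ne_zero ?_ ?_⟩
  · rwa [← Finset.sum_mul]
  · exact Finset.prod_ne_zero_iff.2 fun p _ => Finset.prod_ne_zero_iff.2 fun q hq => hu₂ p q hq

end FQHETorus

open FQHETorus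
theorem propositionP (τ : ℂ) (hτ : 0 < τ.im) (n : ℕ) (hn : 1 ≤ n) (a b : ℝ) (ξ : ℂ)
    (hξ : ξ = a * τ + b) :
    -- the Slater determinant is a global holomorphic section of `L_{n, ξ} ⊠ ⋯ ⊠ L_{n, ξ}`,
    -- as a quasi-periodic function on `ℂⁿ` and as a section of the bundle over `X`
    (slater τ n ξ ∈ quasiPeriodic τ n n ξ ∧
      ∃ σ : BoxBundle.HolomorphicSection τ n 1 (multiplier τ n ξ),
        ∀ z : Fin n → ℂ, σ.toFun (toTorusPow τ n z) = BoxBundle.mk z (slater τ n ξ z)) ∧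
    -- the product formula
    (∃ μ : ℂ, μ ≠ 0 ∧ ∀ z : Fin n → ℂ, slater τ n ξ z = μ * slaterProduct τ n ξ z) ∧
    -- the norm (the integral that defines it converges)
    (MeasureTheory.IntegrableOn
        (innerIntegrand τ n n a (slater τ n ξ) (slater τ n ξ)) (cube n) ∧
      sectionNorm τ n n a (slater τ n ξ)
        = (1 / (2 * (n : ℝ) * τ.im)) ^ ((n : ℝ) / 4) * Real.exp (Real.pi * τ.im * a ^ 2)) := by
  subst hξ
  have hq := slater_mem_quasiPeriodic τ hτ n (a * τ + b)
  obtain ⟨w, hw⟩ := exists_slater_ne_zero hτ hn a b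
  obtain ⟨w', hw'⟩ := exists_slaterProduct_ne_zero hτ hn (a * τ + b)
  exact ⟨⟨hq, exists_holomorphicSection hq⟩, exists_slater_eq_mul_slaterProduct hτ hn hw hw',
    integrableOn_innerIntegrand τ n a hq.1.continuous hq.1.continuous,
    sectionNorm_slater hτ hn a b⟩
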